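/- **Theorem 1.2.** For real $p\neq 0$, $q$ and $\alpha\in(0,1)$ put $$F_{p,q}(\alpha)=\left(1+\left(\frac{2\,\alpha^{p/2}(1-\alpha)^{p/2}}{\alpha^p+(1-\alpha)^p}\right)^{q}\right)^{p-1}\bigl(\alpha^p+(1-\alpha)^p\bigr).$$ For $p>0$ and $q=2/p$ use the same formula for $\alpha\in\{0,1\}$. For $p<0$ and $q=2/p$ let $F_{p,2/p}(0)$ and $F_{p,2/p}(1)$ be the limits of $F_{p,2/p}(\alpha)$ as $\alpha\to0^+$ and $\alpha\to1^-$; these limits exist and equal $0$. 1. For all $\alpha\in[0,1]$, $1\le F_{p,2/p}(\alpha)$ if $p\in(0,1]\cup[2,\infty)$, and $F_{p,2/p}(\alpha)\le 1$ if $p\in(-\infty,0)\cup(1,2)$. 2. If $p>2$ and $q>2/p$, or if $p\in(0,1)$ and $q<2/p$ ($q$ real), then $1\le F_{p,q}(\alpha)$ fails for some $\alpha\in(0,1)$. If $p<0$ and $q>2/p$, or if $p\in(1,2]$ and $q<2/p$, then $F_{p,q}(\alpha)\le 1$ fails for some $\alpha\in(0,1)$. 3. Let $\alpha\in[0,1]$.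 For $p>0$, $p\ne1,2$, one has $F_{p,2/p}(\alpha)=1$ if and only if $\alpha\in\{0,1/2,1\}$. For $p<0$, one has $F_{p,2/p}(\alpha)=1$ if and only if $\alpha=1/2$. -/

import Mathlib

open Set Filter Topology

/-- The ratio `R = 2 α^(p/2) (1-α)^(p/2) / (α^p + (1-α)^p)`. -/
noncomputable def meansRatio (p α : ℝ) : ℝ :=
  2 * α ^ (p / 2) * (1 - α) ^ (p / 2) / (α ^ p + (1 - α) ^ p)

/-- The expression `(1 + R^q)^(p-1) (α^p + (1-α)^p)`, with a general real exponent `q`.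
For `p < 0` or `q < 0` it is only used at `α` strictly between `0` and `1`, where every base
of a power is positive; there are no divisions by zero for `p > 0` and `α` in `[0,1]`. -/
noncomputable def meansRHS (p q α : ℝ) : ℝ :=
  (1 + meansRatio p α ^ q) ^ (p - 1) * (α ^ p + (1 - α) ^ p)

/-! Put α = eˣ/(eˣ + e⁻ˣ). Then log F is the even function `logMeans p q x` (`meansRHS_eq_exp`), it
vanishes at x = 0, and for p, q > 0 it tends to 0 at infinity. So its sign on x > 0 is decided once
its derivative is known to change sign only once.

For q = 2/p the derivative is a factor of constant sign times `tanhQuot p x - 1`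
(`logMeansDeriv_eq`). The derivative of `tanhQuot` is p times a positive factor times `sinhSum p`, a
combination of four hyperbolic sines (`hasDerivAt_tanhQuot`). The Taylor coefficients of `sinhSum`
are power sums, so a Descartes-type argument (`seqCrossesDown_powerSum`) gives them a single sign
change for p > 0, p ≠ 1, 2. By `CrossesDown.of_hasSum` the function inherits this, and
`CrossesDown.of_deriv` and `CrossesDown.pos_of_deriv` carry it up to `logMeans`. For p < 0 all
coefficients are nonnegative and plain monotonicity suffices. The cases p = 1 and p = 2 are
identities.

Strict signs away from x = 0 give the equality cases. Sharpness in q comes from the second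
derivative of `logMeans p q` at 0, which is p(p-1)(2-pq)/2. -/

/-- On `(0, ∞)`, once `f` is nonpositive it is negative from there on. -/
def CrossesDown (f : ℝ → ℝ) : Prop :=
  ∀ x > 0, f x ≤ 0 → ∀ y > x, f y < 0

/-- Once the sequence `u` is negative, it stays nonpositive. -/
def SeqCrossesDown (u : ℕ → ℝ) : Prop :=
  ∀ j, u j < 0 → ∀ k ≥ j, u k ≤ 0

/-! ### Passing a single sign change from a derivative to the function -/

theorem CrossesDown.of_mul {f g h : ℝ → ℝ} (hf : CrossesDown f) (hg : ∀ x > 0, 0 < g x)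
    (heq : ∀ x > 0, h x = g x * f x) : CrossesDown h := by
  intro x hx hhx y hy
  have hy0 : 0 < y := hx.trans hy
  rw [heq x hx] at hhx
  have hfx : f x ≤ 0 := by
    by_contra hcon
    exact absurd (mul_pos (hg x hx) (not_le.1 hcon)) (not_lt.2 hhx)
  rw [heq y hy0]
  exact mul_neg_of_pos_of_neg (hg y hy0) (hf x hx hfx y hy)

/-- Otherwise f increases strictly from the limit 0. Only the right limit at 0 is used, because
`tanhQuot` is 0/0 at the origin. -/
theorem exists_deriv_nonpos_of_tendsto_zero {f f' : ℝ → ℝ}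
    (hf : ∀ x > 0, HasDerivAt f (f' x) x) (h0 : Tendsto f (𝓝[>] 0) (𝓝 0))
    {x : ℝ} (hx : 0 < x) (hfx : f x ≤ 0) : ∃ c ∈ Ioo 0 x, f' c ≤ 0 := by
  by_contra! hcon
  have hmono : StrictMonoOn f (Ioc 0 x) := by
    refine strictMonoOn_of_deriv_pos (convex_Ioc 0 x)
      (fun y hy => (hf y hy.1).continuousAt.continuousWithinAt) fun y hy => ?_
    rw [interior_Ioc] at hy
    rw [(hf y hy.1).deriv]
    exact hcon y hy
  have h1 : f (x / 2) < f x :=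
    hmono ⟨by linarith, by linarith⟩ ⟨hx, le_rfl⟩ (by linarith)
  have h2 : (0 : ℝ) ≤ f (x / 2) := by
    refine le_of_tendsto h0 ?_
    filter_upwards [Ioo_mem_nhdsGT (half_pos hx)] with y hy
    exact (hmono ⟨hy.1, by linarith [hy.2]⟩ ⟨by linarith, by linarith⟩ hy.2).le
  linarith

theorem CrossesDown.strictAntiOn {f f' : ℝ → ℝ} (h : CrossesDown f')
    (hf : ∀ x > 0, HasDerivAt f (f' x) x) {c : ℝ} (hc : 0 < c) (hfc : f' c ≤ 0) :
    StrictAntiOn f (Ici c) := by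
  refine strictAntiOn_of_deriv_neg (convex_Ici c)
    (fun y hy => (hf y (hc.trans_le hy)).continuousAt.continuousWithinAt) fun y hy => ?_
  rw [interior_Ici] at hy
  rw [(hf y (hc.trans hy)).deriv]
  exact h c hc hfc y hy

theorem CrossesDown.of_deriv {f f' : ℝ → ℝ} (h : CrossesDown f')
    (hf : ∀ x > 0, HasDerivAt f (f' x) x) (h0 : Tendsto f (𝓝[>] 0) (𝓝 0)) :
    CrossesDown f := by
  intro x hx hfx y hy
  obtain ⟨c, hc, hfc⟩ := exists_deriv_nonpos_of_tendsto_zero hf h0 hx hfx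
  exact (h.strictAntiOn hf hc.1 hfc hc.2.le (hc.2.le.trans hy.le) hy).trans_le hfx

/-- A nonpositive value would force f to decrease strictly forever after, staying below a negative
number, against the limit 0 at infinity. -/
theorem CrossesDown.pos_of_deriv {f f' : ℝ → ℝ} (h : CrossesDown f')
    (hf : ∀ x > 0, HasDerivAt f (f' x) x) (h0 : Tendsto f (𝓝[>] 0) (𝓝 0))
    (htop : Tendsto f atTop (𝓝 0)) {x : ℝ} (hx : 0 < x) : 0 < f x := by
  by_contra! hfx
  obtain ⟨c, hc, hfc⟩ := exists_deriv_nonpos_of_tendsto_zero hf h0 hx hfx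
  have hanti := h.strictAntiOn hf hc.1 hfc
  have h1 : f (x + 1) < f x := hanti hc.2.le (by grind) (by linarith)
  have h2 : (0 : ℝ) ≤ f (x + 1) := by
    refine le_of_tendsto htop ?_
    filter_upwards [eventually_ge_atTop (x + 1)] with y hy
    exact hanti.antitoneOn (by grind) (by grind) hy
  linarith

theorem neg_of_deriv_neg_of_tendsto_zero {f f' : ℝ → ℝ}
    (hf : ∀ x > 0, HasDerivAt f (f' x) x) (h0 : Tendsto f (𝓝[>] 0) (𝓝 0))
    (hneg : ∀ x > 0, f' x < 0) {x : ℝ} (hx : 0 < x) : f x < 0 := by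
  by_contra! hfx
  obtain ⟨c, hc, hfc⟩ := exists_deriv_nonpos_of_tendsto_zero (f := fun y => -f y)
    (f' := fun y => -f' y) (fun y hy => (hf y hy).neg) (by simpa using h0.neg) hx (by simpa)
  linarith [hneg c hc.1]

/-! ### Sign changes of power sums and power series -/

/-- Discrete form of `CrossesDown.of_deriv`: u can become negative only after the forcing term w
has, and from then on w never lifts u back above 0. -/
theorem SeqCrossesDown.of_succ_eq {u w : ℕ → ℝ} {c : ℝ} (hc : 0 ≤ c) (hw : SeqCrossesDown w)
    (hu0 : 0 ≤ u 0) (hu : ∀ k, u (k + 1) = c * u k + w k) : SeqCrossesDown u := by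
  intro j hj
  have hex : ∃ i < j, w i < 0 := by
    by_contra! hcon
    have : ∀ i ≤ j, 0 ≤ u i := by
      intro i
      induction i with
      | zero => exact fun _ => hu0
      | succ i ih =>
        intro hi
        rw [hu]
        exact add_nonneg (mul_nonneg hc (ih (by lia))) (hcon i (by lia))
    exact absurd (this j le_rfl) (not_le.2 hj)
  obtain ⟨i, hij, hi⟩ := hex
  intro k hk
  induction k, hk using Nat.le_induction with
  | base => exact hj.le
  | succ k hk ih =>
    rw [hu]
    exact add_nonpos (mul_nonpos_of_nonneg_of_nonpos hc ih) (hw i hi k (by lia))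

theorem SeqCrossesDown.of_succ_le {u : ℕ → ℝ} {c : ℝ} (hc : 0 ≤ c)
    (hu : ∀ k, u (k + 1) ≤ c * u k) : SeqCrossesDown u := by
  intro j hj k hk
  induction k, hk using Nat.le_induction with
  | base => exact hj.le
  | succ k hk ih => exact (hu k).trans (mul_nonpos_of_nonneg_of_nonpos hc ih)

/-- Descartes' rule of signs for the power sums `∑ dᵢ lᵢ ^ k` with a zero at `k = 0`. -/
theorem seqCrossesDown_powerSum {d₁ d₂ d₃ d₄ l₁ l₂ l₃ l₄ : ℝ}
    (h0 : d₁ + d₂ + d₃ + d₄ = 0) (h1 : 0 ≤ d₁ * l₁ + d₂ * l₂ + d₃ * l₃ + d₄ * l₄)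
    (hd₁ : d₁ ≤ 0) (h12 : l₂ ≤ l₁) (h23 : l₃ ≤ l₂) (h34 : l₄ ≤ l₃)
    (hl₄ : 0 ≤ l₄) :
    SeqCrossesDown fun k => d₁ * l₁ ^ k + d₂ * l₂ ^ k + d₃ * l₃ ^ k + d₄ * l₄ ^ k := by
  -- With E the shift, E - l₄ and then E - l₂ kill two of the terms. Applying E - l₃ to what remains
  -- leaves only the l₁ term, which has the sign of d₁. The lemma `of_succ_eq` then undoes the two
  -- eliminations.
  have hf : SeqCrossesDown fun k =>
      d₁ * (l₁ - l₄) * (l₁ - l₂) * l₁ ^ k + d₃ * (l₃ - l₄) * (l₃ - l₂) * l₃ ^ k := by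
    refine SeqCrossesDown.of_succ_le (c := l₃) (by linarith) fun k => ?_
    have h : d₁ * ((l₁ - l₄) * (l₁ - l₂) * (l₁ - l₃) * l₁ ^ k) ≤ 0 := by
      have : 0 ≤ l₁ := by linarith
      refine mul_nonpos_of_nonpos_of_nonneg hd₁ (mul_nonneg (mul_nonneg (mul_nonneg ?_ ?_) ?_)
        (by positivity)) <;> linarith
    simp only [pow_succ]
    linarith
  have he : SeqCrossesDown fun k =>
      d₁ * (l₁ - l₄) * l₁ ^ k + d₂ * (l₂ - l₄) * l₂ ^ k + d₃ * (l₃ - l₄) * l₃ ^ k := by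
    refine SeqCrossesDown.of_succ_eq (c := l₂) (by linarith) hf ?_ fun k => ?_
    · simp only [pow_zero]
      linear_combination h1 + l₄ * h0
    · simp only [pow_succ]
      ring
  refine SeqCrossesDown.of_succ_eq (c := l₄) hl₄ he ?_ fun k => ?_
  · simp only [pow_zero]
    linarith
  · simp only [pow_succ]
    ring

theorem pos_of_hasSum_of_nonneg {a : ℕ → ℝ} {s x : ℝ} (hx : 0 < x) (ha : ∀ k, 0 ≤ a k)
    (ha1 : 0 < a 1)
    (hs : HasSum (fun k : ℕ => a k * (x ^ (2 * k + 1) / (2 * k + 1).factorial)) s) : 0 < s :=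
  hasSum_lt (i := 1) (fun k => mul_nonneg (ha k) (by positivity)) (mul_pos ha1 (by positivity))
    hasSum_zero hs

/-- A criterion for power sums `∑ dᵢ lᵢ ^ k` with a zero at `k = 0` to be nonnegative. -/
theorem powerSum_nonneg {d₁ d₂ d₃ d₄ l₁ l₂ l₃ l₄ : ℝ}
    (h0 : d₁ + d₂ + d₃ + d₄ = 0) (h1 : 0 ≤ d₁ * l₁ + d₂ * l₂ + d₃ * l₃ + d₄ * l₄)
    (hd₁ : 0 ≤ d₁) (hd₃ : 0 ≤ d₁ * (l₁ - l₄) * (l₁ - l₂) + d₃ * (l₃ - l₄) * (l₃ - l₂))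
    (h12 : l₂ ≤ l₁) (h23 : l₃ ≤ l₂) (h34 : l₄ ≤ l₃) (hl₄ : 0 ≤ l₄) (k : ℕ) :
    0 ≤ d₁ * l₁ ^ k + d₂ * l₂ ^ k + d₃ * l₃ ^ k + d₄ * l₄ ^ k := by
  -- The same elimination of l₄ and l₂; here the two remaining coefficients have nonnegative sum,
  -- and the larger base carries a nonnegative one.
  have hf (k : ℕ) : 0 ≤ d₁ * (l₁ - l₄) * (l₁ - l₂) * l₁ ^ k +
      d₃ * (l₃ - l₄) * (l₃ - l₂) * l₃ ^ k := by
    have hl₃ : 0 ≤ l₃ := by linarith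
    have hle : l₃ ^ k ≤ l₁ ^ k := pow_le_pow_left₀ hl₃ (by linarith) k
    have hd : 0 ≤ d₁ * (l₁ - l₄) * (l₁ - l₂) :=
      mul_nonneg (mul_nonneg hd₁ (by linarith)) (by linarith)
    linarith [mul_le_mul_of_nonneg_left hle hd, mul_nonneg hd₃ (pow_nonneg hl₃ k)]
  have he (k : ℕ) : 0 ≤ d₁ * (l₁ - l₄) * l₁ ^ k + d₂ * (l₂ - l₄) * l₂ ^ k +
      d₃ * (l₃ - l₄) * l₃ ^ k := by
    induction k with
    | zero => simp only [pow_zero]; linear_combination h1 + l₄ * h0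
    | succ k ih =>
      have h := mul_nonneg (show 0 ≤ l₂ by linarith) ih
      simp only [pow_succ]
      linear_combination h + hf k
  induction k with
  | zero => simp only [pow_zero]; linarith
  | succ k ih =>
    have h := mul_nonneg hl₄ ih
    simp only [pow_succ]
    linear_combination h + he k

/-- An odd power series whose coefficients change sign once, from `+` to `-`, crosses zero
downwards at most once. -/
theorem CrossesDown.of_hasSum {a : ℕ → ℝ} {f : ℝ → ℝ} (ha : SeqCrossesDown a) (ha0 : a 0 = 0)
    (ha1 : 0 < a 1)
    (hf : ∀ x, HasSum (fun k : ℕ => a k * (x ^ (2 * k + 1) / (2 * k + 1).factorial)) (f x)) :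
    CrossesDown f := by
  intro x hx hfx y hxy
  have hy : 0 < y := hx.trans hxy
  by_cases hex : ∃ k, a k < 0
  · classical
    set N := Nat.find hex with hN
    have hNneg : a N < 0 := Nat.find_spec hex
    have hlt : ∀ k < N, 0 ≤ a k := fun k hk => not_lt.1 (Nat.find_min hex hk)
    have hge : ∀ k ≥ N, a k ≤ 0 := ha N hNneg
    have hN1 : 1 < N := by
      by_contra! hcon
      interval_cases h : N
      · linarith
      · linarith
    set r := y / x with hr
    have hr1 : 1 < r := (one_lt_div hx).2 hxy
    have hyr : y = r * x := by rw [hr]; field_simp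
    -- Termwise comparison: before N the coefficients are nonnegative and the power of r is smaller,
    -- from N on they are nonpositive and it is at least as large. The term k = 1 is strict since 1
    -- < N.
    have key : f y < r ^ (2 * N + 1) * f x := by
      refine hasSum_lt (i := 1) (fun k => ?_) ?_ (hf y) ((hf x).mul_left (r ^ (2 * N + 1)))
      · have hpos : 0 ≤ x ^ (2 * k + 1) / ((2 * k + 1).factorial : ℝ) := by positivity
        have heq : a k * (y ^ (2 * k + 1) / ((2 * k + 1).factorial : ℝ)) =
            (a k * r ^ (2 * k + 1)) * (x ^ (2 * k + 1) / ((2 * k + 1).factorial : ℝ)) := by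
          rw [hyr, mul_pow]; ring
        have heq' : r ^ (2 * N + 1) * (a k * (x ^ (2 * k + 1) / ((2 * k + 1).factorial : ℝ))) =
            (a k * r ^ (2 * N + 1)) * (x ^ (2 * k + 1) / ((2 * k + 1).factorial : ℝ)) := by ring
        rw [heq, heq']
        refine mul_le_mul_of_nonneg_right ?_ hpos
        rcases lt_or_ge k N with hk | hk
        · exact mul_le_mul_of_nonneg_left (pow_le_pow_right₀ hr1.le (by lia)) (hlt k hk)
        · exact mul_le_mul_of_nonpos_left (pow_le_pow_right₀ hr1.le (by lia)) (hge k hk)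
      · have hpos : 0 < a 1 * (x ^ (2 * 1 + 1) / ((2 * 1 + 1).factorial : ℝ)) := by positivity
        have heq : a 1 * (y ^ (2 * 1 + 1) / ((2 * 1 + 1).factorial : ℝ)) =
            r ^ (2 * 1 + 1) * (a 1 * (x ^ (2 * 1 + 1) / ((2 * 1 + 1).factorial : ℝ))) := by
          rw [hyr, mul_pow]; ring
        rw [heq]
        exact mul_lt_mul_of_pos_right (pow_lt_pow_right₀ hr1 (by lia)) hpos
    exact key.trans_le (mul_nonpos_of_nonneg_of_nonpos (by positivity) hfx)
  · push Not at hex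
    exact absurd (pos_of_hasSum_of_nonneg hx hex ha1 (hf x)) (not_lt.2 hfx)

/-! ### Sign pattern of the hyperbolic sine sum -/

/-- The combination of hyperbolic sines that governs the sign of the second derivative. -/
noncomputable def sinhSum (p x : ℝ) : ℝ :=
  (p - 1) ^ 2 * Real.sinh ((p + 2) * x) - Real.sinh ((3 * p - 2) * x)
    - 2 * (p - 2) * Real.sinh (p * x) + (2 - p ^ 2) * Real.sinh ((p - 2) * x)

/-- The coefficients of the power series of `sinhSum p`, up to factorials. -/
noncomputable def sinhSumCoeff (p : ℝ) (k : ℕ) : ℝ :=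
  (p - 1) ^ 2 * (p + 2) * ((p + 2) ^ 2) ^ k + -(3 * p - 2) * ((3 * p - 2) ^ 2) ^ k
    + -(2 * (p - 2) * p) * (p ^ 2) ^ k + (2 - p ^ 2) * (p - 2) * ((p - 2) ^ 2) ^ k

theorem hasSum_sinhSum (p x : ℝ) :
    HasSum (fun k : ℕ => sinhSumCoeff p k * (x ^ (2 * k + 1) / (2 * k + 1).factorial))
      (sinhSum p x) := by
  have h (c w : ℝ) : HasSum (fun k : ℕ => c * w * (w ^ 2) ^ k *
      (x ^ (2 * k + 1) / (2 * k + 1).factorial)) (c * Real.sinh (w * x)) := by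
    have e : (fun k : ℕ => c * w * (w ^ 2) ^ k * (x ^ (2 * k + 1) / (2 * k + 1).factorial)) =
        fun k : ℕ => c * ((w * x) ^ (2 * k + 1) / (2 * k + 1).factorial) := by
      ext k
      rw [mul_pow, ← pow_mul, pow_succ w (2 * k)]
      ring
    rw [e]
    exact (Real.hasSum_sinh (w * x)).mul_left c
  have h' := (((h ((p - 1) ^ 2) (p + 2)).add (h (-1) (3 * p - 2))).add
    (h (-(2 * (p - 2))) p)).add (h (2 - p ^ 2) (p - 2))
  have e : sinhSum p x = (p - 1) ^ 2 * Real.sinh ((p + 2) * x)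
      + -1 * Real.sinh ((3 * p - 2) * x) + -(2 * (p - 2)) * Real.sinh (p * x)
      + (2 - p ^ 2) * Real.sinh ((p - 2) * x) := by
    unfold sinhSum; ring
  have e' : (fun k : ℕ => sinhSumCoeff p k * (x ^ (2 * k + 1) / (2 * k + 1).factorial)) = _ :=
    funext fun k => by
      unfold sinhSumCoeff
      rw [add_mul, add_mul, add_mul, ← neg_one_mul (3 * p - 2), ← neg_mul]
  rw [e, e']
  exact h'

theorem sinhSumCoeff_zero (p : ℝ) : sinhSumCoeff p 0 = 0 := by
  unfold sinhSumCoeff; ring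

/-- As the linear term vanishes, this is the leading coefficient and fixes the sign of `sinhSum p`
near 0. -/
theorem sinhSumCoeff_one (p : ℝ) : sinhSumCoeff p 1 = 8 * p * (p - 1) ^ 2 * (p - 2) := by
  unfold sinhSumCoeff; ring

theorem crossesDown_sinhSum {p : ℝ} (hp : 2 < p) : CrossesDown (sinhSum p) := by
  have h1 : 0 < sinhSumCoeff p 1 := by
    rw [sinhSumCoeff_one]
    have : 0 < p - 1 := by linarith
    have : 0 < p - 2 := by linarith
    positivity
  refine CrossesDown.of_hasSum (a := sinhSumCoeff p) ?_ (sinhSumCoeff_zero p) h1 (hasSum_sinhSum p)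
  convert seqCrossesDown_powerSum (d₁ := -(3 * p - 2)) (d₂ := (p - 1) ^ 2 * (p + 2))
    (d₃ := -(2 * (p - 2) * p)) (d₄ := (2 - p ^ 2) * (p - 2)) (l₁ := (3 * p - 2) ^ 2)
    (l₂ := (p + 2) ^ 2) (l₃ := p ^ 2) (l₄ := (p - 2) ^ 2) (by ring)
    (by rw [sinhSumCoeff] at h1; linarith) (by linarith) (by nlinarith) (by nlinarith)
    (by nlinarith) (by positivity) using 1
  ext k
  unfold sinhSumCoeff
  ring

theorem crossesDown_neg_sinhSum {p : ℝ} (hp0 : 0 < p) (hp1 : p ≠ 1) (hp2 : p < 2) :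
    CrossesDown fun x => -sinhSum p x := by
  have h1 : 0 < -sinhSumCoeff p 1 := by
    rw [sinhSumCoeff_one]
    have : 0 < (p - 1) ^ 2 := by have := sub_ne_zero.2 hp1; positivity
    have h2 : 0 < 2 - p := by linarith
    have : 0 < 8 * p * (p - 1) ^ 2 * (2 - p) := by positivity
    linarith
  have h1' := h1
  rw [sinhSumCoeff] at h1'
  refine CrossesDown.of_hasSum (a := fun k => -sinhSumCoeff p k) ?_
    (by simp [sinhSumCoeff_zero]) h1 fun x => ?_
  · have hd : -((p - 1) ^ 2 * (p + 2)) ≤ 0 := by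
      have : 0 ≤ (p - 1) ^ 2 * (p + 2) := by positivity
      linarith
    -- The cases 1 < p, 1/2 ≤ p ≤ 1 and p ≤ 1/2 correspond to the different orderings of the four
    -- bases; (p + 2)² is the largest in each.
    rcases lt_or_ge 1 p with hp | hp
    · convert seqCrossesDown_powerSum (d₂ := 3 * p - 2) (d₁ := -((p - 1) ^ 2 * (p + 2)))
        (d₃ := 2 * (p - 2) * p) (d₄ := -((2 - p ^ 2) * (p - 2))) (l₂ := (3 * p - 2) ^ 2)
        (l₁ := (p + 2) ^ 2) (l₃ := p ^ 2) (l₄ := (p - 2) ^ 2) (by ring)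
        (by linarith) hd (by nlinarith) (by nlinarith) (by nlinarith) (by positivity) using 1
      ext k
      unfold sinhSumCoeff
      ring
    · rcases le_total (1 / 2) p with hp' | hp'
      · convert seqCrossesDown_powerSum (d₄ := 3 * p - 2) (d₁ := -((p - 1) ^ 2 * (p + 2)))
          (d₃ := 2 * (p - 2) * p) (d₂ := -((2 - p ^ 2) * (p - 2))) (l₄ := (3 * p - 2) ^ 2)
          (l₁ := (p + 2) ^ 2) (l₃ := p ^ 2) (l₂ := (p - 2) ^ 2) (by ring)
          (by linarith) hd (by nlinarith) (by nlinarith) (by nlinarith) (by positivity) using 1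
        ext k
        unfold sinhSumCoeff
        ring
      · convert seqCrossesDown_powerSum (d₃ := 3 * p - 2) (d₁ := -((p - 1) ^ 2 * (p + 2)))
          (d₄ := 2 * (p - 2) * p) (d₂ := -((2 - p ^ 2) * (p - 2))) (l₃ := (3 * p - 2) ^ 2)
          (l₁ := (p + 2) ^ 2) (l₄ := p ^ 2) (l₂ := (p - 2) ^ 2) (by ring)
          (by linarith) hd (by nlinarith) (by nlinarith) (by nlinarith)
          (by positivity) using 1
        ext k
        unfold sinhSumCoeff
        ring
  · simpa only [neg_mul] using (hasSum_sinhSum p x).neg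

theorem sinhSum_pos {p x : ℝ} (hp : p < 0) (hx : 0 < x) : 0 < sinhSum p x := by
  have h1 : 0 < sinhSumCoeff p 1 := by
    rw [sinhSumCoeff_one]
    have : 0 < (p - 1) ^ 2 := by
      have : p - 1 ≠ 0 := by linarith
      positivity
    have h2 : 0 < p * (p - 2) := by nlinarith
    have : 0 < 8 * (p * (p - 2)) * (p - 1) ^ 2 := by positivity
    linarith
  have h1' := h1
  rw [sinhSumCoeff] at h1'
  refine pos_of_hasSum_of_nonneg hx (fun k => ?_) h1 (hasSum_sinhSum p x)
  -- The split at -1 is where p² and (p + 2)² exchange order.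
  rcases le_total p (-1) with hp' | hp'
  · convert powerSum_nonneg (d₁ := -(3 * p - 2)) (d₂ := (2 - p ^ 2) * (p - 2))
      (d₃ := -(2 * (p - 2) * p)) (d₄ := (p - 1) ^ 2 * (p + 2)) (l₁ := (3 * p - 2) ^ 2)
      (l₂ := (p - 2) ^ 2) (l₃ := p ^ 2) (l₄ := (p + 2) ^ 2) (by ring)
      (by linarith) (by linarith) ?_ (by nlinarith) (by nlinarith)
      (by nlinarith) (by positivity) k using 1
    · unfold sinhSumCoeff
      ring
    · have e : -(3 * p - 2) * ((3 * p - 2) ^ 2 - (p + 2) ^ 2) * ((3 * p - 2) ^ 2 - (p - 2) ^ 2)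
          + -(2 * (p - 2) * p) * (p ^ 2 - (p + 2) ^ 2) * (p ^ 2 - (p - 2) ^ 2)
          = (2 - 3 * p) * (8 * (-p) * (2 - p)) * (8 * (-p) * (1 - p))
            + (2 * (2 - p) * (-p)) * (4 * (-1 - p)) * (4 * (1 - p)) := by ring
      rw [e]
      have : 0 ≤ -1 - p := by linarith
      have : 0 ≤ 1 - p := by linarith
      have : 0 ≤ 2 - p := by linarith
      have : 0 ≤ 2 - 3 * p := by linarith
      have : 0 ≤ -p := by linarith
      positivity
  · convert powerSum_nonneg (d₁ := -(3 * p - 2)) (d₂ := (2 - p ^ 2) * (p - 2))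
      (d₄ := -(2 * (p - 2) * p)) (d₃ := (p - 1) ^ 2 * (p + 2)) (l₁ := (3 * p - 2) ^ 2)
      (l₂ := (p - 2) ^ 2) (l₄ := p ^ 2) (l₃ := (p + 2) ^ 2) (by ring)
      (by linarith) (by linarith) ?_ (by nlinarith) (by nlinarith)
      (by nlinarith) (by positivity) k using 1
    · unfold sinhSumCoeff
      ring
    · have e : -(3 * p - 2) * ((3 * p - 2) ^ 2 - p ^ 2) * ((3 * p - 2) ^ 2 - (p - 2) ^ 2)
          + (p - 1) ^ 2 * (p + 2) * ((p + 2) ^ 2 - p ^ 2) * ((p + 2) ^ 2 - (p - 2) ^ 2)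
          = 160 * p ^ 2 * (1 - p) ^ 2 * (2 - p) := by ring
      rw [e]
      have : 0 ≤ 2 - p := by linarith
      positivity

/-! ### Hyperbolic tangent -/

theorem Real.hasDerivAt_tanh (x : ℝ) : HasDerivAt Real.tanh (1 - Real.tanh x ^ 2) x := by
  have hc : Real.cosh x ≠ 0 := (Real.cosh_pos x).ne'
  have h := (Real.hasDerivAt_sinh x).div (Real.hasDerivAt_cosh x) hc
  have e : Real.tanh = Real.sinh / Real.cosh := funext Real.tanh_eq_sinh_div_cosh
  rw [e]
  refine h.congr_deriv ?_
  simp only [Pi.div_apply]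
  field_simp

theorem Real.tanh_pos_of_pos {x : ℝ} (hx : 0 < x) : 0 < Real.tanh x := by
  rw [Real.tanh_eq_sinh_div_cosh]
  exact div_pos (Real.sinh_pos_iff.2 hx) (Real.cosh_pos x)

theorem Real.tanh_lt_tanh_of_lt {x y : ℝ} (hxy : x < y) : Real.tanh x < Real.tanh y := by
  refine strictMono_of_deriv_pos (fun z => ?_) hxy
  rw [(Real.hasDerivAt_tanh z).deriv]
  linarith [Real.tanh_sq_lt_one z]

theorem hasDerivAt_tanh_const_mul (p x : ℝ) :
    HasDerivAt (fun y => Real.tanh (p * y)) (p * (1 - Real.tanh (p * x) ^ 2)) x := by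
  have h := (Real.hasDerivAt_tanh (p * x)).comp x ((hasDerivAt_id x).const_mul p)
  refine h.congr_deriv ?_
  ring

theorem tanh_mul_lt_mul_tanh {s y : ℝ} (hs : 1 < s) (hy : 0 < y) :
    Real.tanh (s * y) < s * Real.tanh y := by
  have hd (x : ℝ) : HasDerivAt (fun z => Real.tanh (s * z) - s * Real.tanh z)
      (s * (1 - Real.tanh (s * x) ^ 2) - s * (1 - Real.tanh x ^ 2)) x :=
    (hasDerivAt_tanh_const_mul s x).sub ((Real.hasDerivAt_tanh x).const_mul s)
  have h0 : Tendsto (fun z => Real.tanh (s * z) - s * Real.tanh z) (𝓝[>] 0) (𝓝 0) := by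
    have h := (hd 0).continuousAt.tendsto
    simp only [mul_zero, Real.tanh_zero, sub_zero] at h
    exact h.mono_left nhdsWithin_le_nhds
  have h := neg_of_deriv_neg_of_tendsto_zero (fun x _ => hd x) h0 (fun x hx => ?_) hy
  · linarith
  · have h1 : Real.tanh x < Real.tanh (s * x) := Real.tanh_lt_tanh_of_lt (by nlinarith)
    have h2 := Real.tanh_pos_of_pos hx
    have h3 : Real.tanh x ^ 2 < Real.tanh (s * x) ^ 2 := pow_lt_pow_left₀ h1 h2.le two_ne_zero
    nlinarith

/-! ### The logarithm of F: derivative and limits -/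

/-- The logarithm of `meansRHS p q α` at `α = exp x / (exp x + exp (-x))`. -/
noncomputable def logMeans (p q x : ℝ) : ℝ :=
  (p - 1) * Real.log ((1 + Real.cosh (p * x) ^ (-q)) / 2) + Real.log (Real.cosh (p * x))
    - p * Real.log (Real.cosh x)

/-- The derivative of `logMeans p q`. -/
noncomputable def logMeansDeriv (p q x : ℝ) : ℝ :=
  Real.tanh (p * x) * (p - (p - 1) * (q * p) *
    (Real.cosh (p * x) ^ (-q) / (1 + Real.cosh (p * x) ^ (-q)))) - p * Real.tanh x

theorem hasDerivAt_cosh_const_mul (p x : ℝ) :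
    HasDerivAt (fun y => Real.cosh (p * y)) (p * Real.sinh (p * x)) x := by
  have h := (Real.hasDerivAt_cosh (p * x)).comp x ((hasDerivAt_id x).const_mul p)
  refine h.congr_deriv ?_
  ring

theorem hasDerivAt_cosh_rpow (p q x : ℝ) :
    HasDerivAt (fun y => Real.cosh (p * y) ^ q)
      (q * p * Real.tanh (p * x) * Real.cosh (p * x) ^ q) x := by
  have hc := Real.cosh_pos (p * x)
  have h := (hasDerivAt_cosh_const_mul p x).rpow_const (p := q) (Or.inl hc.ne')
  refine h.congr_deriv ?_
  rw [Real.rpow_sub_one hc.ne', Real.tanh_eq_sinh_div_cosh]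
  field_simp

theorem hasDerivAt_logMeans (p q x : ℝ) :
    HasDerivAt (logMeans p q) (logMeansDeriv p q x) x := by
  have hc := Real.cosh_pos (p * x)
  have hc' := Real.cosh_pos x
  have hw : 0 < Real.cosh (p * x) ^ (-q) := Real.rpow_pos_of_pos hc _
  have h1 := ((((hasDerivAt_cosh_rpow p (-q) x).const_add 1).div_const 2).log
    (by positivity)).const_mul (p - 1)
  have h2 := (hasDerivAt_cosh_const_mul p x).log hc.ne'
  have h3 := ((Real.hasDerivAt_cosh x).log hc'.ne').const_mul p
  refine ((h1.add h2).sub h3).congr_deriv ?_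
  unfold logMeansDeriv
  rw [Real.tanh_eq_sinh_div_cosh, Real.tanh_eq_sinh_div_cosh]
  field_simp
  ring

theorem logMeans_zero (p q : ℝ) : logMeans p q 0 = 0 := by
  simp [logMeans]

theorem tendsto_logMeans_zero (p q : ℝ) : Tendsto (logMeans p q) (𝓝[>] 0) (𝓝 0) := by
  have h := (hasDerivAt_logMeans p q 0).continuousAt.tendsto
  rw [logMeans_zero] at h
  exact h.mono_left nhdsWithin_le_nhds

theorem tendsto_log_cosh_sub : Tendsto (fun y => Real.log (Real.cosh y) - y) atTop
    (𝓝 (-Real.log 2)) := by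
  have e : (fun y => Real.log (Real.cosh y) - y) =
      fun y => Real.log (1 + Real.exp (-(2 * y))) - Real.log 2 := by
    ext y
    have h : Real.cosh y = Real.exp y * (1 + Real.exp (-(2 * y))) / 2 := by
      rw [Real.cosh_eq, mul_add, ← Real.exp_add]
      ring_nf
    rw [h, Real.log_div (by positivity) two_ne_zero, Real.log_mul (by positivity) (by positivity),
      Real.log_exp]
    ring
  rw [e]
  have h1 : Tendsto (fun y : ℝ => Real.exp (-(2 * y))) atTop (𝓝 0) :=
    Real.tendsto_exp_neg_atTop_nhds_zero.comp (tendsto_id.const_mul_atTop two_pos)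
  have h2 : Tendsto (fun y : ℝ => Real.log (1 + Real.exp (-(2 * y)))) atTop (𝓝 0) := by
    have h := (h1.const_add 1).log (by norm_num)
    simpa using h
  simpa using h2.sub_const (Real.log 2)

theorem tendsto_cosh_atTop : Tendsto Real.cosh atTop atTop := by
  refine tendsto_atTop_mono (fun x => ?_) (Real.tendsto_exp_atTop.atTop_div_const two_pos)
  rw [Real.cosh_eq]
  have := Real.exp_pos (-x)
  linarith

theorem tendsto_logMeans_atTop {p q : ℝ} (hp : 0 < p) (hq : 0 < q) :
    Tendsto (logMeans p q) atTop (𝓝 0) := by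
  have hpx : Tendsto (fun x : ℝ => p * x) atTop atTop := tendsto_id.const_mul_atTop hp
  have h1 : Tendsto (fun x => Real.cosh (p * x) ^ (-q)) atTop (𝓝 0) :=
    (tendsto_rpow_neg_atTop hq).comp (tendsto_cosh_atTop.comp hpx)
  have h2 := (((h1.const_add 1).div_const 2).log (by norm_num)).const_mul (p - 1)
  have h3 := (h2.add (tendsto_log_cosh_sub.comp hpx)).sub (tendsto_log_cosh_sub.const_mul p)
  have e : (p - 1) * Real.log ((1 + 0) / 2) + -Real.log 2 - p * -Real.log 2 = 0 := by
    rw [add_zero, one_div, Real.log_inv]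
    ring
  rw [e] at h3
  refine h3.congr fun x => ?_
  simp only [logMeans, Function.comp_apply]
  ring

/-! ### The comparison quotient for q = 2/p -/

/-- The common denominator of the comparison quotient. -/
noncomputable def tanhSum (p x : ℝ) : ℝ := p * Real.tanh x + (p - 2) * Real.tanh (p * x)

/-- The quotient whose comparison with `1` gives the sign of `logMeansDeriv p (2 / p)`. -/
noncomputable def tanhQuot (p x : ℝ) : ℝ :=
  Real.cosh (p * x) ^ (2 / p) * (p * (Real.tanh (p * x) - Real.tanh x)) / tanhSum p x

theorem logMeansDeriv_eq {p x : ℝ} (hp : p ≠ 0) (hv : tanhSum p x ≠ 0) :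
    logMeansDeriv p (2 / p) x =
      tanhSum p x / (1 + Real.cosh (p * x) ^ (2 / p)) * (tanhQuot p x - 1) := by
  have hw : 0 < Real.cosh (p * x) ^ (2 / p) := Real.rpow_pos_of_pos (Real.cosh_pos _) _
  unfold logMeansDeriv tanhQuot
  rw [Real.rpow_neg (Real.cosh_pos _).le]
  field_simp
  unfold tanhSum
  ring

theorem sinhSum_eq (p x : ℝ) : sinhSum p x = 4 * Real.cosh (p * x) ^ 3 * Real.cosh x ^ 2 *
    (Real.tanh (p * x) * (Real.tanh (p * x) - Real.tanh x) * tanhSum p x + (p - 1) *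
      (p * Real.tanh x * (1 - Real.tanh (p * x) ^ 2)
        - Real.tanh (p * x) * (1 - Real.tanh x ^ 2))) := by
  have hc := (Real.cosh_pos (p * x)).ne'
  have hc' := (Real.cosh_pos x).ne'
  have e : 4 * Real.cosh (p * x) ^ 3 * Real.cosh x ^ 2 *
    (Real.tanh (p * x) * (Real.tanh (p * x) - Real.tanh x) * tanhSum p x + (p - 1) *
      (p * Real.tanh x * (1 - Real.tanh (p * x) ^ 2)
        - Real.tanh (p * x) * (1 - Real.tanh x ^ 2))) =
      4 * (Real.sinh (p * x) * (Real.sinh (p * x) * Real.cosh x - Real.sinh x * Real.cosh (p * x)) *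
        (p * Real.sinh x * Real.cosh (p * x) + (p - 2) * Real.sinh (p * x) * Real.cosh x) +
        (p - 1) * (p * Real.sinh x * Real.cosh x * Real.cosh (p * x)
          * (Real.cosh (p * x) ^ 2 - Real.sinh (p * x) ^ 2) -
          Real.sinh (p * x) * Real.cosh (p * x) ^ 2 * (Real.cosh x ^ 2 - Real.sinh x ^ 2))) := by
    rw [tanhSum, Real.tanh_eq_sinh_div_cosh, Real.tanh_eq_sinh_div_cosh]
    field_simp
  have h1 : (p + 2) * x = p * x + x + x := by ring
  have h2 : (3 * p - 2) * x = p * x + p * x + p * x - x - x := by ring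
  have h3 : (p - 2) * x = p * x - x - x := by ring
  rw [e, sinhSum, h1, h2, h3]
  generalize p * x = y
  simp only [Real.sinh_eq, Real.cosh_eq, neg_add, Real.exp_add, Real.exp_neg,
    sub_eq_add_neg, neg_neg]
  have hx := (Real.exp_pos x).ne'
  have hy := (Real.exp_pos y).ne'
  field_simp
  ring

/-- Since (2/p)·p = 2, differentiating the power only multiplies it by 2 tanh(px). The power
therefore factors out, leaving the polynomial in tanh x and tanh(px) of `sinhSum_eq`. -/
theorem hasDerivAt_tanhQuot {p x : ℝ} (hp : p ≠ 0) (hv : tanhSum p x ≠ 0) :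
    HasDerivAt (tanhQuot p) (p * (Real.cosh (p * x) ^ (2 / p) /
      (2 * Real.cosh (p * x) ^ 3 * Real.cosh x ^ 2 * tanhSum p x ^ 2)) * sinhSum p x) x := by
  have hc := (Real.cosh_pos (p * x)).ne'
  have hc' := (Real.cosh_pos x).ne'
  have hT := hasDerivAt_tanh_const_mul p x
  have ht := Real.hasDerivAt_tanh x
  have hV : HasDerivAt (tanhSum p) _ x := (ht.const_mul p).add (hT.const_mul (p - 2))
  have h := ((hasDerivAt_cosh_rpow p (2 / p) x).mul ((hT.sub ht).const_mul p)).div hV hv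
  have e : tanhQuot p = ((fun y => Real.cosh (p * y) ^ (2 / p)) *
    fun y => p * ((fun y => Real.tanh (p * y)) - Real.tanh) y) / tanhSum p := rfl
  rw [e]
  refine h.congr_deriv ?_
  rw [sinhSum_eq]
  simp only [Pi.mul_apply, Pi.sub_apply]
  field_simp
  unfold tanhSum
  ring

theorem tendsto_tanhQuot {p : ℝ} (hp : p ≠ 0) (hp1 : p ≠ 1) :
    Tendsto (fun x => tanhQuot p x - 1) (𝓝[>] 0) (𝓝 0) := by
  have hle : 𝓝[>] (0 : ℝ) ≤ 𝓝[≠] 0 := nhdsWithin_mono _ fun x hx => (ne_of_gt hx)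
  have hT : Tendsto (fun x => Real.tanh (p * x) / x) (𝓝[>] 0) (𝓝 p) := by
    have h := (hasDerivAt_iff_tendsto_slope_zero.1 (hasDerivAt_tanh_const_mul p 0)).mono_left hle
    simpa [div_eq_inv_mul] using h
  have ht : Tendsto (fun x => Real.tanh x / x) (𝓝[>] 0) (𝓝 1) := by
    have h := (hasDerivAt_iff_tendsto_slope_zero.1 (Real.hasDerivAt_tanh 0)).mono_left hle
    simpa [div_eq_inv_mul] using h
  have hC : Tendsto (fun x => Real.cosh (p * x) ^ (2 / p)) (𝓝[>] 0) (𝓝 1) := by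
    have h := (hasDerivAt_cosh_rpow p (2 / p) 0).continuousAt.tendsto
    simp only [mul_zero, Real.cosh_zero, Real.one_rpow] at h
    exact h.mono_left nhdsWithin_le_nhds
  -- After division by x, numerator and denominator of the quotient both tend to p(p - 1).
  have hne : p * 1 + (p - 2) * p ≠ 0 := by
    have e : p * 1 + (p - 2) * p = p * (p - 1) := by ring
    rw [e]
    exact mul_ne_zero hp (sub_ne_zero.2 hp1)
  have h := ((hC.mul ((hT.sub ht).const_mul p)).div
    ((ht.const_mul p).add (hT.const_mul (p - 2))) hne).sub_const 1
  have e : 1 * (p * (p - 1)) / (p * 1 + (p - 2) * p) - 1 = 0 := by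
    rw [sub_eq_zero, div_eq_one_iff_eq hne]
    ring
  rw [e] at h
  refine h.congr' ?_
  filter_upwards [self_mem_nhdsWithin] with x hx
  have hx0 : x ≠ 0 := ne_of_gt hx
  simp only [tanhQuot, tanhSum, Pi.div_apply]
  congr 1
  rw [← mul_div_mul_right _ _ hx0]
  congr 1 <;> field_simp

theorem tanhSum_pos_of_one_lt {p x : ℝ} (hp : 1 < p) (hx : 0 < x) : 0 < tanhSum p x := by
  have h1 := tanh_mul_lt_mul_tanh hp hx
  have h2 := Real.tanh_pos_of_pos hx
  have h3 : 0 < Real.tanh (p * x) := Real.tanh_pos_of_pos (by positivity)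
  unfold tanhSum
  nlinarith

theorem tanhSum_neg_of_lt_one {p x : ℝ} (hp : 0 < p) (hp1 : p < 1) (hx : 0 < x) :
    tanhSum p x < 0 := by
  have h1 := tanh_mul_lt_mul_tanh (s := p⁻¹) (one_lt_inv₀ hp |>.2 hp1) (mul_pos hp hx)
  rw [inv_mul_cancel_left₀ hp.ne', inv_mul_eq_div, lt_div_iff₀' hp] at h1
  have h3 : 0 < Real.tanh (p * x) := Real.tanh_pos_of_pos (by positivity)
  unfold tanhSum
  nlinarith

theorem tanhSum_pos_of_neg {p x : ℝ} (hp : p < 0) (hx : 0 < x) : 0 < tanhSum p x := by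
  have h3 : 0 < Real.tanh (-p * x) := Real.tanh_pos_of_pos (by nlinarith)
  have h2 := Real.tanh_pos_of_pos hx
  have e : Real.tanh (p * x) = -Real.tanh (-p * x) := by
    rw [← Real.tanh_neg]; ring_nf
  unfold tanhSum
  rw [e]
  rcases lt_trichotomy (-p) 1 with h | h | h
  · have hp' : 0 < -p := by linarith
    have h1 := tanh_mul_lt_mul_tanh (s := (-p)⁻¹) (one_lt_inv₀ hp' |>.2 h) (mul_pos hp' hx)
    rw [inv_mul_cancel_left₀ hp'.ne', inv_mul_eq_div, lt_div_iff₀' hp'] at h1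
    nlinarith
  · rw [h, one_mul] at *
    nlinarith
  · have h1 : Real.tanh x < Real.tanh (-p * x) := Real.tanh_lt_tanh_of_lt (by nlinarith)
    nlinarith

/-! ### Sign of the logarithm for q = 2/p -/

theorem logMeans_pos_of_two_lt {p x : ℝ} (hp : 2 < p) (hx : 0 < x) :
    0 < logMeans p (2 / p) x := by
  have hp0 : 0 < p := by linarith
  have hv : ∀ x > 0, 0 < tanhSum p x := fun x hx => tanhSum_pos_of_one_lt (by linarith) hx
  refine CrossesDown.pos_of_deriv (f' := logMeansDeriv p (2 / p)) ?_
    (fun x _ => hasDerivAt_logMeans _ _ _) (tendsto_logMeans_zero _ _)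
    (tendsto_logMeans_atTop hp0 (by positivity)) hx
  refine CrossesDown.of_mul (f := fun x => tanhQuot p x - 1) ?_ (fun x hx => ?_)
    fun x hx => logMeansDeriv_eq hp0.ne' (hv x hx).ne'
  · refine CrossesDown.of_deriv ?_
      (fun x hx => (hasDerivAt_tanhQuot hp0.ne' (hv x hx).ne').sub_const 1)
      (tendsto_tanhQuot hp0.ne' (by linarith))
    refine (crossesDown_sinhSum hp).of_mul (fun x hx => ?_) fun x hx => rfl
    have := hv x hx
    have := Real.cosh_pos (p * x)
    have := Real.cosh_pos x
    positivity
  · have := hv x hx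
    have := Real.cosh_pos (p * x)
    positivity

theorem crossesDown_one_sub_tanhQuot {p : ℝ} (hp : 0 < p) (hp1 : p ≠ 1) (hp2 : p < 2)
    (hv : ∀ x > 0, tanhSum p x ≠ 0) : CrossesDown fun x => -(tanhQuot p x - 1) := by
  refine CrossesDown.of_deriv ?_
    (fun x hx => ((hasDerivAt_tanhQuot hp.ne' (hv x hx)).sub_const 1).neg)
    (by simpa using (tendsto_tanhQuot hp.ne' hp1).neg)
  refine (crossesDown_neg_sinhSum hp hp1 hp2).of_mul (fun x hx => ?_)
    fun x hx => (mul_neg _ _).symm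
  have := hv x hx
  have := Real.cosh_pos (p * x)
  have := Real.cosh_pos x
  positivity

theorem logMeans_neg_of_mem_Ioo {p x : ℝ} (hp1 : 1 < p) (hp2 : p < 2) (hx : 0 < x) :
    logMeans p (2 / p) x < 0 := by
  have hp0 : 0 < p := by linarith
  have hv : ∀ x > 0, 0 < tanhSum p x := fun x hx => tanhSum_pos_of_one_lt hp1 hx
  rw [← neg_pos]
  refine CrossesDown.pos_of_deriv (f := fun x => -logMeans p (2 / p) x)
    (f' := fun x => -logMeansDeriv p (2 / p) x) ?_
    (fun x _ => (hasDerivAt_logMeans _ _ _).neg) (by simpa using (tendsto_logMeans_zero p _).neg)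
    (by simpa using (tendsto_logMeans_atTop hp0 (div_pos two_pos hp0)).neg) hx
  refine (crossesDown_one_sub_tanhQuot hp0 hp1.ne' hp2 fun x hx => (hv x hx).ne').of_mul
    (g := fun x => tanhSum p x / (1 + Real.cosh (p * x) ^ (2 / p))) (fun x hx => ?_)
    fun x hx => by rw [logMeansDeriv_eq hp0.ne' (hv x hx).ne', mul_neg]
  have := hv x hx
  have := Real.cosh_pos (p * x)
  positivity

theorem logMeans_pos_of_lt_one {p x : ℝ} (hp0 : 0 < p) (hp1 : p < 1) (hx : 0 < x) :
    0 < logMeans p (2 / p) x := by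
  have hv : ∀ x > 0, tanhSum p x < 0 := fun x hx => tanhSum_neg_of_lt_one hp0 hp1 hx
  refine CrossesDown.pos_of_deriv (f' := logMeansDeriv p (2 / p)) ?_
    (fun x _ => hasDerivAt_logMeans _ _ _) (tendsto_logMeans_zero p _)
    (tendsto_logMeans_atTop hp0 (by positivity)) hx
  -- Compared with p > 2, both `tanhSum` and the direction of crossing of `tanhQuot - 1` are
  -- reversed, so the derivative still crosses downwards.
  refine (crossesDown_one_sub_tanhQuot hp0 hp1.ne (by linarith) fun x hx => (hv x hx).ne).of_mul
    (g := fun x => -tanhSum p x / (1 + Real.cosh (p * x) ^ (2 / p))) (fun x hx => ?_)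
    fun x hx => by rw [logMeansDeriv_eq hp0.ne' (hv x hx).ne]; ring
  have : 0 < -tanhSum p x := neg_pos.2 (hv x hx)
  have := Real.cosh_pos (p * x)
  positivity

theorem logMeans_neg_of_neg {p x : ℝ} (hp : p < 0) (hx : 0 < x) :
    logMeans p (2 / p) x < 0 := by
  have hv : ∀ x > 0, 0 < tanhSum p x := fun x hx => tanhSum_pos_of_neg hp hx
  refine neg_of_deriv_neg_of_tendsto_zero (fun x _ => hasDerivAt_logMeans _ _ _)
    (tendsto_logMeans_zero p _) (fun x hx => ?_) hx
  rw [logMeansDeriv_eq hp.ne (hv x hx).ne']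
  have hQ : tanhQuot p x - 1 < 0 := by
    refine neg_of_deriv_neg_of_tendsto_zero
      (fun x hx => (hasDerivAt_tanhQuot hp.ne (hv x hx).ne').sub_const 1)
      (tendsto_tanhQuot hp.ne (by linarith)) (fun x hx => ?_) hx
    have := hv x hx
    have := Real.cosh_pos (p * x)
    have := Real.cosh_pos x
    exact mul_neg_of_neg_of_pos (mul_neg_of_neg_of_pos hp (by positivity)) (sinhSum_pos hp hx)
  have := hv x hx
  have := Real.cosh_pos (p * x)
  exact mul_neg_of_pos_of_neg (by positivity) hQ

/-- Close to `0`, the sign of `logMeans p q` is that of its second derivative at `0`. -/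
theorem exists_mul_logMeans_pos {p q : ℝ} (hp : p ≠ 0) (hp1 : p ≠ 1) (hq : p * q ≠ 2) :
    ∃ x > 0, 0 < p * (p - 1) * (2 - p * q) * logMeans p q x := by
  set m := p * (p - 1) * (2 - p * q) with hm
  have hm0 : m ≠ 0 := mul_ne_zero (mul_ne_zero hp (sub_ne_zero.2 hp1)) (sub_ne_zero.2 hq.symm)
  have hw : (0 : ℝ) < Real.cosh (p * 0) ^ (-q) := Real.rpow_pos_of_pos (Real.cosh_pos _) _
  -- The second derivative of `logMeans` at 0 is m/2; the extra factor m makes it m²/2 > 0, so both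
  -- signs of m are treated at once.
  have hd : HasDerivAt (fun x => m * logMeansDeriv p q x) (m * (m / 2)) 0 := by
    have hW := hasDerivAt_cosh_rpow p (-q) 0
    have h := (((hasDerivAt_tanh_const_mul p 0).mul (((hW.div (hW.const_add 1)
      (by positivity)).const_mul ((p - 1) * (q * p))).const_sub p)).sub
      ((Real.hasDerivAt_tanh 0).const_mul p)).const_mul m
    refine h.congr_deriv ?_
    simp only [mul_zero, Real.tanh_zero, Real.cosh_zero, Real.one_rpow, Pi.div_apply, hm]
    ring
  have hev := eventually_nhdsWithin_sign_eq_of_deriv_pos (f := fun x => m * logMeansDeriv p q x)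
    (x₀ := 0) (by rw [hd.deriv]; have := mul_self_pos.2 hm0; linarith)
    (by simp [logMeansDeriv])
  obtain ⟨ε, hε, hball⟩ := Metric.eventually_nhds_iff.1 hev
  refine ⟨ε / 2, half_pos hε, ?_⟩
  by_contra! hcon
  have h0 : Tendsto (fun x => m * logMeans p q x) (𝓝[>] 0) (𝓝 0) := by
    simpa using (tendsto_logMeans_zero p q).const_mul m
  obtain ⟨c, hc, hfc⟩ := exists_deriv_nonpos_of_tendsto_zero
    (fun x _ => (hasDerivAt_logMeans p q x).const_mul m) h0 (half_pos hε) hcon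
  have hs := hball (y := c) (by rw [Real.dist_eq, sub_zero, abs_of_pos hc.1]; linarith [hc.2])
  rw [sub_zero, sign_pos hc.1, sign_eq_one_iff] at hs
  linarith

/-! ### The change of variable -/

/-- The parameter `x` with `α = exp x / (exp x + exp (-x))`. -/
noncomputable def halfLogit (α : ℝ) : ℝ := (Real.log α - Real.log (1 - α)) / 2

theorem cosh_mul_halfLogit {α : ℝ} (hα : α ∈ Ioo (0 : ℝ) 1) (p : ℝ) :
    Real.cosh (p * halfLogit α) =
      (α ^ p + (1 - α) ^ p) / (2 * α ^ (p / 2) * (1 - α) ^ (p / 2)) := by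
  have ha : 0 < α := hα.1
  have hb : 0 < 1 - α := by linarith [hα.2]
  have h1 : Real.exp (p * halfLogit α) = α ^ (p / 2) / (1 - α) ^ (p / 2) := by
    rw [Real.rpow_def_of_pos ha, Real.rpow_def_of_pos hb, ← Real.exp_sub, halfLogit]
    ring_nf
  have ha2 : α ^ p = α ^ (p / 2) * α ^ (p / 2) := by
    rw [← Real.rpow_add ha, add_halves]
  have hb2 : (1 - α) ^ p = (1 - α) ^ (p / 2) * (1 - α) ^ (p / 2) := by
    rw [← Real.rpow_add hb, add_halves]
  rw [Real.cosh_eq, Real.exp_neg, h1, ha2, hb2]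
  have := Real.rpow_pos_of_pos ha (p / 2)
  have := Real.rpow_pos_of_pos hb (p / 2)
  field_simp

/-- Here cosh(px) is the reciprocal of `meansRatio`, and (α(1-α))^(1/2) = 1/(2 cosh x) turns α^p +
(1-α)^p into 2^(1-p) cosh(px)/cosh(x)^p. The factor 2^(1-p) is the halving inside `logMeans`. -/
theorem meansRHS_eq_exp {α : ℝ} (hα : α ∈ Ioo (0 : ℝ) 1) (p q : ℝ) :
    meansRHS p q α = Real.exp (logMeans p q (halfLogit α)) := by
  have ha : 0 < α := hα.1
  have hb : 0 < 1 - α := by linarith [hα.2]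
  have hA : 0 < α ^ (p / 2) := Real.rpow_pos_of_pos ha (p / 2)
  have hB : 0 < (1 - α) ^ (p / 2) := Real.rpow_pos_of_pos hb (p / 2)
  have hN : 0 < α ^ p + (1 - α) ^ p :=
    add_pos (Real.rpow_pos_of_pos ha p) (Real.rpow_pos_of_pos hb p)
  have hR : Real.cosh (p * halfLogit α) = (meansRatio p α)⁻¹ := by
    rw [cosh_mul_halfLogit hα, meansRatio, inv_div]
  have hRpos : 0 < meansRatio p α := by unfold meansRatio; positivity
  have hw : Real.cosh (p * halfLogit α) ^ (-q) = meansRatio p α ^ q := by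
    rw [hR, Real.inv_rpow hRpos.le, Real.rpow_neg hRpos.le, inv_inv]
  have hRq := Real.rpow_pos_of_pos hRpos q
  have hc := Real.cosh_pos (halfLogit α)
  have hcp := Real.cosh_pos (p * halfLogit α)
  have hc1 : Real.cosh (halfLogit α) ^ p = (2 ^ p * (α ^ (p / 2) * (1 - α) ^ (p / 2)))⁻¹ := by
    have h := cosh_mul_halfLogit hα 1
    rw [one_mul, Real.rpow_one, Real.rpow_one, add_sub_cancel, one_div, mul_assoc] at h
    rw [h, Real.inv_rpow (by positivity), Real.mul_rpow two_pos.le (by positivity),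
      Real.mul_rpow (by positivity) (by positivity), ← Real.rpow_mul ha.le, ← Real.rpow_mul hb.le]
    ring_nf
  have hexp : Real.exp (logMeans p q (halfLogit α)) =
      ((1 + meansRatio p α ^ q) / 2) ^ (p - 1) * Real.cosh (p * halfLogit α) /
        Real.cosh (halfLogit α) ^ p := by
    rw [logMeans, hw, Real.exp_sub, Real.exp_add, Real.exp_log hcp,
      Real.rpow_def_of_pos (show 0 < (1 + meansRatio p α ^ q) / 2 by positivity),
      Real.rpow_def_of_pos hc, mul_comm (p - 1), mul_comm p (Real.log _)]
  rw [hexp, hc1, cosh_mul_halfLogit hα, Real.div_rpow (by positivity) two_pos.le,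
    Real.rpow_sub_one two_ne_zero, meansRHS]
  have := Real.rpow_pos_of_pos (two_pos (α := ℝ)) p
  field_simp

theorem halfLogit_eq_zero_iff {α : ℝ} (hα : α ∈ Ioo (0 : ℝ) 1) : halfLogit α = 0 ↔ α = 1 / 2 := by
  have hb : 0 < 1 - α := by linarith [hα.2]
  constructor
  · intro h
    have : Real.log α = Real.log (1 - α) := by unfold halfLogit at h; linarith
    have := Real.log_injOn_pos (mem_Ioi.2 hα.1) (mem_Ioi.2 hb) this
    linarith
  · rintro rfl
    norm_num [halfLogit]

theorem exists_halfLogit_eq (x : ℝ) : ∃ α ∈ Ioo (0 : ℝ) 1, halfLogit α = x := by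
  have hE := Real.exp_pos (2 * x)
  have h1 : 1 - Real.exp (2 * x) / (1 + Real.exp (2 * x)) = 1 / (1 + Real.exp (2 * x)) := by
    field_simp
    ring
  refine ⟨Real.exp (2 * x) / (1 + Real.exp (2 * x)), ⟨by positivity, ?_⟩, ?_⟩
  · rw [div_lt_one (by positivity)]
    linarith
  · rw [halfLogit, h1, Real.log_div hE.ne' (by positivity), Real.log_div one_ne_zero (by positivity),
      Real.log_exp, Real.log_one]
    ring

theorem logMeans_abs (p q x : ℝ) : logMeans p q |x| = logMeans p q x := by
  rcases abs_choice x with h | h <;> rw [h]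
  simp [logMeans]

theorem logMeans_pos_of_lt_one_or_two_lt {p x : ℝ} (hp : 0 < p) (hp' : p < 1 ∨ 2 < p)
    (hx : x ≠ 0) : 0 < logMeans p (2 / p) x := by
  rw [← logMeans_abs]
  rcases hp' with h | h
  · exact logMeans_pos_of_lt_one hp h (abs_pos.2 hx)
  · exact logMeans_pos_of_two_lt h (abs_pos.2 hx)

theorem logMeans_neg_of_neg_or_mem_Ioo {p x : ℝ} (hp : p < 0 ∨ p ∈ Ioo (1 : ℝ) 2)
    (hx : x ≠ 0) : logMeans p (2 / p) x < 0 := by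
  rw [← logMeans_abs]
  rcases hp with h | h
  · exact logMeans_neg_of_neg h (abs_pos.2 hx)
  · exact logMeans_neg_of_mem_Ioo h.1 h.2 (abs_pos.2 hx)

theorem logMeans_one (q x : ℝ) : logMeans 1 q x = 0 := by
  simp [logMeans]

theorem logMeans_two_one (x : ℝ) : logMeans 2 1 x = 0 := by
  have hc := Real.cosh_pos x
  have hc2 := Real.cosh_pos (2 * x)
  have h : (1 + (Real.cosh (2 * x))⁻¹) / 2 * Real.cosh (2 * x) = Real.cosh x ^ 2 := by
    have h2 := Real.cosh_two_mul x
    have h3 := Real.cosh_sq x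
    field_simp
    linarith
  have hl := congrArg Real.log h
  rw [Real.log_mul (by positivity) hc2.ne', Real.log_pow] at hl
  rw [logMeans, Real.rpow_neg_one]
  push_cast at hl
  linarith

/-! ### Endpoints -/

theorem meansRHS_one_sub (p q α : ℝ) : meansRHS p q (1 - α) = meansRHS p q α := by
  unfold meansRHS meansRatio
  rw [sub_sub_cancel, add_comm ((1 - α) ^ p), mul_right_comm]

theorem meansRHS_zero {p q : ℝ} (hp : 0 < p) (hq : q ≠ 0) : meansRHS p q 0 = 1 := by
  unfold meansRHS meansRatio
  rw [Real.zero_rpow hp.ne', Real.zero_rpow (half_pos hp).ne', mul_zero, zero_mul, zero_div,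
    Real.zero_rpow hq]
  simp

theorem meansRHS_one {p q : ℝ} (hp : 0 < p) (hq : q ≠ 0) : meansRHS p q 1 = 1 := by
  rw [← meansRHS_one_sub, sub_self, meansRHS_zero hp hq]

theorem Icc_zero_one_cases {α : ℝ} (hα : α ∈ Icc (0 : ℝ) 1) :
    α = 0 ∨ α = 1 ∨ α ∈ Ioo (0 : ℝ) 1 := by
  rcases hα.1.eq_or_lt with h | h
  · exact Or.inl h.symm
  · rcases hα.2.eq_or_lt with h' | h'
    · exact Or.inr (Or.inl h')
    · exact Or.inr (Or.inr ⟨h, h'⟩)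

/-- Near α = 0 the terms R^(2/p) and α^p dominate. Dropping the 1 beside the first and (1-α)^p
beside the second raises the value, as the exponents p - 1 and (2-p)/p are negative; the remaining
powers of α combine to α. -/
theorem meansRHS_le_of_neg {p α : ℝ} (hp : p < 0) (hα : α ∈ Ioo (0 : ℝ) 1) :
    meansRHS p (2 / p) α ≤ 2 ^ (2 / p * (p - 1)) * (1 - α) ^ (p - 1) * α := by
  have ha : 0 < α := hα.1
  have hb : 0 < 1 - α := by linarith [hα.2]
  have hap := Real.rpow_pos_of_pos ha p
  have hbp := Real.rpow_pos_of_pos hb p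
  have hA := Real.rpow_pos_of_pos ha (p / 2)
  have hB := Real.rpow_pos_of_pos hb (p / 2)
  have hp0 : p ≠ 0 := hp.ne
  unfold meansRHS
  set N := α ^ p + (1 - α) ^ p with hN
  have hNpos : 0 < N := add_pos hap hbp
  have hRpos : 0 < meansRatio p α := by unfold meansRatio; positivity
  have hRq := Real.rpow_pos_of_pos hRpos (2 / p)
  have h1 : (1 + meansRatio p α ^ (2 / p)) ^ (p - 1) ≤ meansRatio p α ^ (2 / p * (p - 1)) := by
    rw [Real.rpow_mul hRpos.le]
    exact Real.rpow_le_rpow_of_nonpos hRq (by linarith) (by linarith)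
  have h2 : meansRatio p α ^ (2 / p * (p - 1)) = 2 ^ (2 / p * (p - 1)) * α ^ (p - 1) *
      (1 - α) ^ (p - 1) / N ^ (2 / p * (p - 1)) := by
    unfold meansRatio
    rw [Real.div_rpow (by positivity) hNpos.le, Real.mul_rpow (by positivity) hB.le,
      Real.mul_rpow two_pos.le hA.le, ← Real.rpow_mul ha.le, ← Real.rpow_mul hb.le]
    have e : p / 2 * (2 / p * (p - 1)) = p - 1 := by field_simp
    rw [e]
  have h3 : N / N ^ (2 / p * (p - 1)) ≤ α ^ (2 - p) := by
    have e : N / N ^ (2 / p * (p - 1)) = N ^ (1 - 2 / p * (p - 1)) := by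
      rw [Real.rpow_sub hNpos, Real.rpow_one]
    have e' : 1 - 2 / p * (p - 1) = (2 - p) / p := by field_simp; ring
    rw [e, e']
    calc N ^ ((2 - p) / p) ≤ (α ^ p) ^ ((2 - p) / p) :=
          Real.rpow_le_rpow_of_nonpos hap (by linarith)
            (div_nonpos_of_nonneg_of_nonpos (by linarith) hp.le)
      _ = α ^ (2 - p) := by
          rw [← Real.rpow_mul ha.le]
          congr 1
          field_simp
  have h4 : α ^ (p - 1) * α ^ (2 - p) = α := by
    rw [← Real.rpow_add ha]
    ring_nf
    exact Real.rpow_one α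
  have hb1 := Real.rpow_pos_of_pos hb (p - 1)
  have ha1 := Real.rpow_pos_of_pos ha (p - 1)
  have h2p := Real.rpow_pos_of_pos (two_pos (α := ℝ)) (2 / p * (p - 1))
  calc (1 + meansRatio p α ^ (2 / p)) ^ (p - 1) * N
      ≤ meansRatio p α ^ (2 / p * (p - 1)) * N := mul_le_mul_of_nonneg_right h1 hNpos.le
    _ = 2 ^ (2 / p * (p - 1)) * α ^ (p - 1) * (1 - α) ^ (p - 1) *
          (N / N ^ (2 / p * (p - 1))) := by rw [h2]; ring
    _ ≤ 2 ^ (2 / p * (p - 1)) * α ^ (p - 1) * (1 - α) ^ (p - 1) * α ^ (2 - p) :=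
        mul_le_mul_of_nonneg_left h3 (by positivity)
    _ = 2 ^ (2 / p * (p - 1)) * (1 - α) ^ (p - 1) * (α ^ (p - 1) * α ^ (2 - p)) := by ring
    _ = _ := by rw [h4]

theorem tendsto_meansRHS_zero {p : ℝ} (hp : p < 0) :
    Tendsto (meansRHS p (2 / p)) (𝓝[>] 0) (𝓝 0) := by
  have hb : Tendsto (fun α : ℝ => 2 ^ (2 / p * (p - 1)) * (1 - α) ^ (p - 1) * α) (𝓝[>] 0)
      (𝓝 0) := by
    have hc : ContinuousAt (fun α : ℝ => (2 : ℝ) ^ (2 / p * (p - 1)) * (1 - α) ^ (p - 1) * α) 0 :=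
      (continuousAt_const.mul ((continuousAt_const.sub continuousAt_id).rpow_const
        (Or.inl (by simp)))).mul continuousAt_id
    have h := hc.tendsto
    rw [mul_zero] at h
    exact h.mono_left nhdsWithin_le_nhds
  refine tendsto_of_tendsto_of_tendsto_of_le_of_le' tendsto_const_nhds hb ?_ ?_
  · filter_upwards [Ioo_mem_nhdsGT one_pos] with α hα
    rw [meansRHS_eq_exp hα]
    exact (Real.exp_pos _).le
  · filter_upwards [Ioo_mem_nhdsGT one_pos] with α hα
    exact meansRHS_le_of_neg hp hα

theorem tendsto_meansRHS_one {p : ℝ} (hp : p < 0) :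
    Tendsto (meansRHS p (2 / p)) (𝓝[<] 1) (𝓝 0) := by
  have h : Tendsto (fun α : ℝ => 1 - α) (𝓝[<] 1) (𝓝[>] 0) := by
    refine tendsto_nhdsWithin_iff.2 ⟨?_, ?_⟩
    · have h : Tendsto (fun α : ℝ => 1 - α) (𝓝 1) (𝓝 (1 - 1)) := tendsto_id.const_sub 1
      rw [sub_self] at h
      exact h.mono_left nhdsWithin_le_nhds
    · filter_upwards [self_mem_nhdsWithin] with α hα
      exact sub_pos.2 (mem_Iio.1 hα)
  exact ((tendsto_meansRHS_zero hp).comp h).congr fun α => meansRHS_one_sub _ _ _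

/-! ### Sharpness, equality and the inequalities in terms of α -/

theorem exists_meansRHS_lt_one {p q : ℝ} (h : p * (p - 1) * (2 - p * q) < 0) :
    ∃ α ∈ Ioo (0 : ℝ) 1, ¬ 1 ≤ meansRHS p q α := by
  obtain ⟨x, -, hx⟩ := exists_mul_logMeans_pos (p := p) (q := q) (by rintro rfl; simp at h)
    (by rintro rfl; simp at h) (by intro h'; simp [h'] at h)
  obtain ⟨α, hα, rfl⟩ := exists_halfLogit_eq x
  refine ⟨α, hα, ?_⟩
  rw [meansRHS_eq_exp hα, Real.one_le_exp_iff, not_le]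
  exact neg_of_mul_pos_right hx h.le

theorem exists_one_lt_meansRHS {p q : ℝ} (h : 0 < p * (p - 1) * (2 - p * q)) :
    ∃ α ∈ Ioo (0 : ℝ) 1, ¬ meansRHS p q α ≤ 1 := by
  obtain ⟨x, -, hx⟩ := exists_mul_logMeans_pos (p := p) (q := q) (by rintro rfl; simp at h)
    (by rintro rfl; simp at h) (by intro h'; simp [h'] at h)
  obtain ⟨α, hα, rfl⟩ := exists_halfLogit_eq x
  refine ⟨α, hα, ?_⟩
  rw [meansRHS_eq_exp hα, Real.exp_le_one_iff, not_le]
  exact pos_of_mul_pos_right hx h.le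

theorem one_eq_meansRHS_iff {p α : ℝ} (hp : p ≠ 0) (hp1 : p ≠ 1) (hp2 : p ≠ 2)
    (hα : α ∈ Ioo (0 : ℝ) 1) : 1 = meansRHS p (2 / p) α ↔ α = 1 / 2 := by
  rw [meansRHS_eq_exp hα, eq_comm, Real.exp_eq_one_iff, ← halfLogit_eq_zero_iff hα]
  refine ⟨fun h => ?_, fun h => by rw [h, logMeans_zero]⟩
  by_contra hx
  by_cases hneg : p < 0 ∨ p ∈ Ioo (1 : ℝ) 2
  · exact (logMeans_neg_of_neg_or_mem_Ioo hneg hx).ne h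
  · rw [mem_Ioo] at hneg
    push Not at hneg
    have hp0 : 0 < p := lt_of_le_of_ne hneg.1 hp.symm
    refine (logMeans_pos_of_lt_one_or_two_lt hp0 ?_ hx).ne' h
    rcases lt_or_gt_of_ne hp1 with h1 | h1
    · exact Or.inl h1
    · exact Or.inr (lt_of_le_of_ne (hneg.2 h1) hp2.symm)

theorem meansRHS_le_one {p α : ℝ} (hp : p < 0 ∨ p ∈ Ioo (1 : ℝ) 2) (hα : α ∈ Ioo (0 : ℝ) 1) :
    meansRHS p (2 / p) α ≤ 1 := by
  rw [meansRHS_eq_exp hα, Real.exp_le_one_iff]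
  by_cases hx : halfLogit α = 0
  · rw [hx, logMeans_zero]
  · exact (logMeans_neg_of_neg_or_mem_Ioo hp hx).le

theorem one_le_meansRHS {p α : ℝ} (hp : p ∈ Ioc (0 : ℝ) 1 ∪ Ici 2) (hα : α ∈ Ioo (0 : ℝ) 1) :
    1 ≤ meansRHS p (2 / p) α := by
  rw [meansRHS_eq_exp hα, Real.one_le_exp_iff]
  by_cases hx : halfLogit α = 0
  · rw [hx, logMeans_zero]
  rcases hp with ⟨h0, h1⟩ | h2
  · rcases h1.eq_or_lt with rfl | h1
    · rw [logMeans_one]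
    · exact (logMeans_pos_of_lt_one_or_two_lt h0 (Or.inl h1) hx).le
  · rcases (mem_Ici.1 h2).eq_or_lt with rfl | h2
    · rw [div_self two_ne_zero, logMeans_two_one]
    · exact (logMeans_pos_of_lt_one_or_two_lt (by linarith) (Or.inr h2) hx).le

theorem theorem1p2 :
    -- the inequality, for `p` in `(0,1] ∪ [2,∞)`
    (∀ p ∈ Ioc (0 : ℝ) 1 ∪ Ici 2, ∀ α ∈ Icc (0 : ℝ) 1, 1 ≤ meansRHS p (2 / p) α) ∧
    -- the reverse inequality, for `p` in `(1,2)`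
    (∀ p ∈ Ioo (1 : ℝ) 2, ∀ α ∈ Icc (0 : ℝ) 1, meansRHS p (2 / p) α ≤ 1) ∧
    -- the reverse inequality, for `p < 0`; at the endpoints, where `0 ^ p` is infinite, the
    -- right side is understood as its limit, which exists and is `0`
    (∀ p < (0 : ℝ), (∀ α ∈ Ioo (0 : ℝ) 1, meansRHS p (2 / p) α ≤ 1) ∧
      Tendsto (meansRHS p (2 / p)) (𝓝[>] 0) (𝓝 0) ∧
      Tendsto (meansRHS p (2 / p)) (𝓝[<] 1) (𝓝 0)) ∧
    -- sharpness of the exponent `2 / p`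
    (∀ p > (2 : ℝ), ∀ q > 2 / p, ∃ α ∈ Ioo (0 : ℝ) 1, ¬ 1 ≤ meansRHS p q α) ∧
    (∀ p ∈ Ioo (0 : ℝ) 1, ∀ q < 2 / p, ∃ α ∈ Ioo (0 : ℝ) 1, ¬ 1 ≤ meansRHS p q α) ∧
    (∀ p < (0 : ℝ), ∀ q > 2 / p, ∃ α ∈ Ioo (0 : ℝ) 1, ¬ meansRHS p q α ≤ 1) ∧
    (∀ p ∈ Ioc (1 : ℝ) 2, ∀ q < 2 / p, ∃ α ∈ Ioo (0 : ℝ) 1, ¬ meansRHS p q α ≤ 1) ∧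
    -- the cases of equality
    (∀ p > (0 : ℝ), p ≠ 1 → p ≠ 2 → ∀ α ∈ Icc (0 : ℝ) 1,
      (1 = meansRHS p (2 / p) α ↔ α ∈ ({0, 1 / 2, 1} : Set ℝ))) ∧
    (∀ p < (0 : ℝ), ∀ α ∈ Ioo (0 : ℝ) 1,
      (1 = meansRHS p (2 / p) α ↔ α = 1 / 2)) := by
  have hend : ∀ p > (0 : ℝ), meansRHS p (2 / p) 0 = 1 ∧ meansRHS p (2 / p) 1 = 1 := fun p hp =>
    ⟨meansRHS_zero hp (div_pos two_pos hp).ne', meansRHS_one hp (div_pos two_pos hp).ne'⟩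
  refine ⟨fun p hp α hα => ?_, fun p hp α hα => ?_, fun p hp => ⟨fun α hα =>
    meansRHS_le_one (Or.inl hp) hα, tendsto_meansRHS_zero hp, tendsto_meansRHS_one hp⟩,
    fun p hp q hq => ?_, fun p hp q hq => ?_, fun p hp q hq => ?_, fun p hp q hq => ?_,
    fun p hp hp1 hp2 α hα => ?_,
    fun p hp α hα => one_eq_meansRHS_iff hp.ne (by linarith) (by linarith) hα⟩
  · have hp0 : 0 < p := by
      rcases hp with h | h
      · exact h.1
      · exact two_pos.trans_le h
    rcases Icc_zero_one_cases hα with rfl | rfl | hα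
    · exact (hend p hp0).1.ge
    · exact (hend p hp0).2.ge
    · exact one_le_meansRHS hp hα
  · have hp0 : 0 < p := one_pos.trans hp.1
    rcases Icc_zero_one_cases hα with rfl | rfl | hα
    · exact (hend p hp0).1.le
    · exact (hend p hp0).2.le
    · exact meansRHS_le_one (Or.inr hp) hα
  · have hp0 : 0 < p := by linarith
    rw [gt_iff_lt, div_lt_iff₀' hp0] at hq
    exact exists_meansRHS_lt_one
      (mul_neg_of_pos_of_neg (mul_pos hp0 (by linarith)) (by linarith))
  · rw [lt_div_iff₀' hp.1] at hq
    exact exists_meansRHS_lt_one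
      (mul_neg_of_neg_of_pos (mul_neg_of_pos_of_neg hp.1 (by linarith [hp.2])) (by linarith))
  · rw [gt_iff_lt, div_lt_iff_of_neg' hp] at hq
    exact exists_one_lt_meansRHS
      (mul_pos (mul_pos_of_neg_of_neg hp (by linarith)) (by linarith))
  · have hp0 : 0 < p := one_pos.trans hp.1
    rw [lt_div_iff₀' hp0] at hq
    exact exists_one_lt_meansRHS
      (mul_pos (mul_pos hp0 (by linarith [hp.1])) (by linarith))
  · rcases Icc_zero_one_cases hα with rfl | rfl | hα
    · simp [(hend p hp).1]
    · simp [(hend p hp).2]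
    · rw [one_eq_meansRHS_iff hp.ne' hp1 hp2 hα]
      simp [hα.1.ne', hα.2.ne]
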